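/- Let $A$ be a real $m\times n$ matrix with singular values $\sigma_1\ge\sigma_2\ge\dots\ge\sigma_{\min\{m,n\}}\ge 0$. Let $k\ge 2$ and $p\ge 2$ be integers with $k+p\le\min\{m,n\}$. Let $\Omega$ be an $n\times(k+p)$ standard Gaussian matrix, that is, a random matrix whose entries are independent standard normal random variables, and put $Y=A\Omega$. Let $P_Y$ denote the orthogonal projector of $\mathbb R^m$ onto the range (column space) of $Y$, and let $\|M\|_F=\bigl(\sum_{i,j}M_{ij}^2\bigr)^{1/2}$ denote the Frobenius norm. Then $\|(I-P_Y)A\|_F$ is integrable and $$\mathbb E\,\|(I-P_Y)A\|_F\;\le\;\Bigl(1+\frac{k}{p-1}\Bigr)^{1/2}\Bigl(\sum_{j=k+1}^{\min\{m,n\}}\sigma_j^2\Bigr)^{1/2}.$$ -/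

import Mathlib

open MeasureTheory ProbabilityTheory

/-- The Frobenius norm of a real matrix, `(∑ i, ∑ j, M i j ^ 2) ^ (1/2)`. -/
noncomputable def frobNorm {m n : ℕ} (M : Matrix (Fin m) (Fin n) ℝ) : ℝ :=
  √(∑ i, ∑ j, M i j ^ 2)

/-- The matrix of the orthogonal projector of Euclidean space `ℝᵐ` onto the range (column space)
of the `m × l` matrix `M`. -/
noncomputable def orthProj {m l : ℕ} (M : Matrix (Fin m) (Fin l) ℝ) :
    Matrix (Fin m) (Fin m) ℝ :=
  Matrix.toEuclideanLin.symm
    ((LinearMap.range (Matrix.toEuclideanLin M)).starProjection :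
      EuclideanSpace ℝ (Fin m) →ₗ[ℝ] EuclideanSpace ℝ (Fin m))

/-- `singularValue A j` is the `j`-th largest singular value `σ_j` of `A`, counted from `j = 1`
(Mathlib counts singular values from `0`); only used for `1 ≤ j`. -/
noncomputable def singularValue {m n : ℕ} (A : Matrix (Fin m) (Fin n) ℝ) (j : ℕ) : ℝ :=
  (Matrix.toEuclideanLin A).singularValues (j - 1)

/-- A random `n × l` matrix is standard Gaussian if its entries are independent standard normal
random variables. -/
structure IsStdGaussianMatrix {S : Type*} [MeasurableSpace S] {n l : ℕ}
    (Ω : S → Matrix (Fin n) (Fin l) ℝ) (μ : Measure S) : Prop where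
  hasLaw : ∀ i j, HasLaw (fun s => Ω s i j) (gaussianReal 0 1) μ
  indep : iIndepFun (fun (ij : Fin n × Fin l) (s : S) => Ω s ij.1 ij.2) μ

/-!
Write `b` for an orthonormal basis of right singular vectors of `A`, so that `‖A (b i)‖ = σ_{i+1}`.
By rotational invariance one may assume that `Ω = ∑ i, b i ⊗ g i` with independent standard Gaussian
rows `g i` in `ℝ^(k+p)`.

The squared residual `‖(I - P_Y) A‖_F²` is `∑ i, dist (A (b i), range Y)²`, so it is bounded by
choosing a point of `range Y` for each `i`. For `i ≥ k` the point `0` costs `σ_{i+1}²`. For `i < k`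
take `Y z_i`, where `z_i` satisfies `⟪g j, z_i⟫ = δ_ij` for all `j < k`; then
`Y z_i = A (b i) + ∑ j ≥ k, ⟪g j, z_i⟫ A (b j)`, and the error has conditional mean square
`‖z_i‖² ∑ j ≥ k, ‖A (b j)‖²` given the first `k` rows, because `z_i` depends on these only
(`frobNorm_sub_orthProj_mul_sq_le`, `lintegral_resample_frobNorm_sq_le`).

The best `z_i` has norm `1 / dist (g i, W_i)`, where `W_i` is spanned by the other `k - 1` among the
first `k` rows. As `g i` is independent of `W_i`, which has codimension at least `p + 1`, the squared
distance dominates a chi-squared variable with `p + 1` degrees of freedom, whose inverse has mean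
`1 / (p - 1)` (`lintegral_inv_infDist_sq_otherRowsSpan_le`). Thus the second moment of the residual
is at most `(1 + k / (p - 1)) ∑_{j > k} σ_j²`, and `(𝔼 f)² ≤ 𝔼 f²` gives the claim.

All moments are computed as lower Lebesgue integrals, with the value `∞` for an inverse distance
when the rows are dependent. Measurability of the residual comes from writing a distance to a span
as an infimum over rational combinations (`measurable_infDist_span`).
-/

open scoped ENNReal RealInnerProductSpace

/-! ### Standard Gaussian vectors: invariance, resampling, second moments -/

/-- The law of a family of independent standard normal variables indexed by `ι`. -/
noncomputable abbrev gaussianPi (ι : Type*) [Fintype ι] : Measure (ι → ℝ) :=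
  Measure.pi fun _ => gaussianReal 0 1

/-- A linear map with orthonormal rows sends a standard Gaussian vector to a standard Gaussian vector.
Rotations and the passage to coordinates along an orthonormal family are both of this form. -/
theorem gaussianPi_map_of_orthonormal {ι κ : Type*} [Fintype ι] [Fintype κ] [DecidableEq κ]
    (f : κ → ι → ℝ) (hf : ∀ a b, ∑ i, f a i * f b i = if a = b then 1 else 0) :
    (gaussianPi ι).map (fun x a => ∑ i, f a i * x i) = gaussianPi κ := by
  have hT : Measurable (fun (x : ι → ℝ) (a : κ) => ∑ i, f a i * x i) := by fun_prop
  have key : ((gaussianPi ι).map (fun x a => ∑ i, f a i * x i)).map (WithLp.toLp 2)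
      = stdGaussian (EuclideanSpace ℝ κ) := by
    refine Measure.ext_of_charFun (E := EuclideanSpace ℝ κ) ?_
    funext t
    set s : EuclideanSpace ℝ ι := WithLp.toLp 2 fun i => ∑ a, t a * f a i with hs
    have hst : ‖s‖ ^ 2 = ‖t‖ ^ 2 := by
      simp only [EuclideanSpace.real_norm_sq_eq, hs]
      calc ∑ i, (∑ a, t a * f a i) ^ 2
          = ∑ i, ∑ a, ∑ b, t a * t b * (f a i * f b i) := by
            refine Finset.sum_congr rfl fun i _ => ?_
            rw [sq, Finset.sum_mul_sum]
            exact Finset.sum_congr rfl fun a _ => Finset.sum_congr rfl fun b _ => by ring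
        _ = ∑ a, ∑ b, t a * t b * ∑ i, f a i * f b i := by
            rw [Finset.sum_comm]
            refine Finset.sum_congr rfl fun a _ => ?_
            rw [Finset.sum_comm]
            simp_rw [Finset.mul_sum]
        _ = ∑ a, t a ^ 2 := by
            simp_rw [hf]
            simp [sq]
    have hstd : charFun ((gaussianPi ι).map (WithLp.toLp 2)) s
        = charFun (stdGaussian (EuclideanSpace ℝ κ)) t := by
      rw [map_pi_eq_stdGaussian, charFun_stdGaussian, charFun_stdGaussian]
      norm_cast
      rw [hst]
    rw [← hstd, charFun_apply, charFun_apply, Measure.map_map (by fun_prop) hT,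
      integral_map ((WithLp.measurable_toLp 2 _).comp hT).aemeasurable
        (Measurable.aestronglyMeasurable (by fun_prop)),
      integral_map (by fun_prop) (Measurable.aestronglyMeasurable (by fun_prop))]
    congr 1
    funext x
    congr 3
    simp only [Function.comp_apply, hs, PiLp.inner_apply, RCLike.inner_apply, conj_trivial]
    simp_rw [Finset.mul_sum, Finset.sum_mul]
    rw [Finset.sum_comm]
    exact Finset.sum_congr rfl fun a _ => Finset.sum_congr rfl fun b _ => by ring
  rw [← map_pi_eq_stdGaussian] at key
  have := congrArg (Measure.map (WithLp.ofLp (p := 2) (V := κ → ℝ))) key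
  rw [Measure.map_map (by fun_prop) (by fun_prop), Measure.map_map (by fun_prop) (by fun_prop)]
    at this
  simpa [Function.comp_def, Measure.map_map (WithLp.measurable_ofLp 2 (κ → ℝ))
    (WithLp.measurable_toLp 2 (κ → ℝ))] using this

/-- Taking the coordinates in `P` from one Gaussian vector and the others from an independent copy
gives a Gaussian vector again. -/
theorem gaussianPi_map_piecewise {ι : Type*} [Fintype ι] (P : ι → Prop) [DecidablePred P] :
    ((gaussianPi ι).prod (gaussianPi ι)).map
      (fun x i => if P i then x.1 i else x.2 i) = gaussianPi ι := by
  classical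
  symm
  refine Measure.pi_eq fun s hs => ?_
  have hm : Measurable
      (fun (x : (ι → ℝ) × (ι → ℝ)) i => if P i then x.1 i else x.2 i) := by
    refine measurable_pi_lambda _ fun i => ?_
    split_ifs <;> fun_prop
  rw [Measure.map_apply hm (MeasurableSet.univ_pi hs)]
  have : (fun (x : (ι → ℝ) × (ι → ℝ)) i => if P i then x.1 i else x.2 i) ⁻¹' (Set.univ.pi s)
      = (Set.univ.pi fun i => if P i then s i else Set.univ) ×ˢ
        (Set.univ.pi fun i => if P i then Set.univ else s i) := by
    ext x
    simp only [Set.mem_preimage, Set.mem_pi, Set.mem_univ, forall_true_left, Set.mem_prod,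
      ← forall_and]
    refine forall_congr' fun i => ?_
    split_ifs <;> simp
  rw [this, Measure.prod_prod, Measure.pi_pi, Measure.pi_pi, ← Finset.prod_mul_distrib]
  refine Finset.prod_congr rfl fun i _ => ?_
  split_ifs <;> simp

/-- Fubini for the coordinates in `P` against the remaining ones. Both integrations run over the full
index set, which avoids product measures over subtypes. -/
theorem lintegral_gaussianPi_eq_resample {ι : Type*} [Fintype ι] (P : ι → Prop) [DecidablePred P]
    {f : (ι → ℝ) → ℝ≥0∞} (hf : Measurable f) :
    ∫⁻ x, f x ∂(gaussianPi ι)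
      = ∫⁻ x, ∫⁻ y, f (fun i => if P i then x i else y i) ∂(gaussianPi ι) ∂(gaussianPi ι) := by
  have hm : Measurable
      (fun (x : (ι → ℝ) × (ι → ℝ)) i => if P i then x.1 i else x.2 i) := by
    refine measurable_pi_lambda _ fun i => ?_
    split_ifs <;> fun_prop
  rw [← gaussianPi_map_piecewise P, lintegral_map hf hm, gaussianPi_map_piecewise P]
  exact lintegral_prod _ (hf.comp hm).aemeasurable

theorem lintegral_gaussianPi_sq_linear {ι : Type*} [Fintype ι] (c : ι → ℝ) :
    ∫⁻ x, ENNReal.ofReal ((∑ i, c i * x i) ^ 2) ∂(gaussianPi ι)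
      = ENNReal.ofReal (∑ i, c i ^ 2) := by
  have hmem : ∀ i, MemLp (fun t : ℝ => c i * t) 2 (gaussianReal 0 1) := fun i =>
    IsGaussian.memLp_two_id.const_mul _
  have hmem' : ∀ i, MemLp (fun x : ι → ℝ => c i * x i) 2 (gaussianPi ι) := fun i =>
    (hmem i).comp_measurePreserving (measurePreserving_eval _ i)
  have hsum : MemLp (fun x : ι → ℝ => ∑ i, c i * x i) 2 (gaussianPi ι) :=
    memLp_finsetSum _ fun i _ => hmem' i
  rw [← ofReal_integral_eq_lintegral_ofReal hsum.integrable_sq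
    (Filter.Eventually.of_forall fun _ => sq_nonneg _)]
  congr 1
  have hmean : ∫ x, ∑ i, c i * x i ∂(gaussianPi ι) = 0 := by
    rw [integral_finsetSum _ fun i _ => (hmem' i).integrable (by norm_num)]
    refine Finset.sum_eq_zero fun i _ => ?_
    rw [integral_comp_eval (μ := fun _ : ι => gaussianReal 0 1) (f := fun t => c i * t)
      (hmem i).aestronglyMeasurable, integral_const_mul, integral_id_gaussianReal, mul_zero]
  have hvar := variance_sum_pi (μ := fun _ : ι => gaussianReal 0 1)
    (X := fun i t => c i * t) hmem
  rw [← variance_of_integral_eq_zero hsum.aestronglyMeasurable.aemeasurable hmean]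
  convert hvar using 1
  · congr 1
    ext x
    simp
  · refine Finset.sum_congr rfl fun i _ => ?_
    change _ = Var[fun x ↦ _ * (id x); gaussianReal 0 1]
    rw [variance_const_mul, variance_id_gaussianReal]
    simp

/-! ### The inverse moment of a chi-squared variable -/

theorem integral_exp_neg_mul_sq_gaussianReal {t : ℝ} (ht : 0 ≤ t) :
    ∫ x, Real.exp (-t * x ^ 2) ∂(gaussianReal 0 1) = (1 + 2 * t) ^ (-(1 / 2) : ℝ) := by
  rw [integral_gaussianReal_eq_integral_smul one_ne_zero]
  have h1 : ∀ x : ℝ, gaussianPDFReal 0 1 x • Real.exp (-t * x ^ 2)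
      = (√(2 * Real.pi))⁻¹ * Real.exp (-(t + 1 / 2) * x ^ 2) := by
    intro x
    simp only [gaussianPDFReal, smul_eq_mul, NNReal.coe_one, mul_one, sub_zero]
    rw [mul_assoc, ← Real.exp_add]
    congr 2
    ring
  simp_rw [h1]
  rw [integral_const_mul, integral_gaussian, ← Real.sqrt_inv, ← Real.sqrt_mul (by positivity),
    Real.rpow_neg (by positivity), ← Real.sqrt_eq_rpow, ← Real.sqrt_inv]
  congr 1
  have := Real.pi_pos
  field_simp
  ring

theorem integrable_exp_neg_mul_sq_gaussianReal {t : ℝ} (ht : 0 ≤ t) :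
    Integrable (fun x => Real.exp (-t * x ^ 2)) (gaussianReal 0 1) := by
  refine Integrable.of_bound (Measurable.aestronglyMeasurable (by fun_prop)) 1
    (Filter.Eventually.of_forall fun x => ?_)
  rw [Real.norm_of_nonneg (Real.exp_nonneg _), Real.exp_le_one_iff]
  nlinarith [mul_nonneg ht (sq_nonneg x)]

theorem lintegral_exp_neg_mul_sum_sq_gaussianPi {κ : Type*} [Fintype κ] {t : ℝ} (ht : 0 ≤ t) :
    ∫⁻ x, ENNReal.ofReal (Real.exp (-t * ∑ a, x a ^ 2)) ∂(gaussianPi κ)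
      = ENNReal.ofReal ((1 + 2 * t) ^ (-(Fintype.card κ / 2) : ℝ)) := by
  have h1 : ∀ x : κ → ℝ, Real.exp (-t * ∑ a, x a ^ 2) = ∏ a, Real.exp (-t * x a ^ 2) := by
    intro x
    rw [Finset.mul_sum, Real.exp_sum]
  simp_rw [h1]
  rw [← ofReal_integral_eq_lintegral_ofReal
    (Integrable.fintype_prod fun _ => integrable_exp_neg_mul_sq_gaussianReal ht)
    (Filter.Eventually.of_forall fun x => by positivity),
    integral_fintype_prod_eq_prod (f := fun (_ : κ) y => Real.exp (-t * y ^ 2))]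
  simp_rw [integral_exp_neg_mul_sq_gaussianReal ht]
  rw [Finset.prod_const, Finset.card_univ, ← Real.rpow_mul_natCast (by positivity)]
  congr 2
  ring

/-- The Laplace representation of `1 / r`; for `r = 0` both sides are `∞`. -/
theorem lintegral_Ioi_exp_neg_mul {r : ℝ} (hr : 0 ≤ r) :
    ∫⁻ t in Set.Ioi (0 : ℝ), ENNReal.ofReal (Real.exp (-t * r)) = (ENNReal.ofReal r)⁻¹ := by
  rcases hr.eq_or_lt with rfl | hr
  · simp
  · have h1 : ∀ t : ℝ, -t * r = -r * t := fun t => by ring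
    simp_rw [h1]
    rw [← ofReal_integral_eq_lintegral_ofReal (exp_neg_integrableOn_Ioi 0 hr)
      (Filter.Eventually.of_forall fun x => Real.exp_nonneg _),
      integral_exp_mul_Ioi (by linarith), ← ENNReal.ofReal_inv_of_pos hr]
    congr 1
    simp [neg_div_neg_eq]

theorem lintegral_Ioi_one_add_two_mul_rpow {d : ℝ} (hd : 2 < d) :
    ∫⁻ t in Set.Ioi (0 : ℝ), ENNReal.ofReal ((1 + 2 * t) ^ (-(d / 2)))
      = ENNReal.ofReal (1 / (d - 2)) := by
  have hderiv : ∀ x ∈ Set.Ici (0 : ℝ),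
      HasDerivAt (fun t : ℝ => -(1 / (d - 2)) * (1 + 2 * t) ^ (-(d / 2 - 1)))
        ((1 + 2 * x) ^ (-(d / 2))) x := by
    intro x hx
    have hx' : (0 : ℝ) < 1 + 2 * x := by
      have : (0 : ℝ) ≤ x := hx
      linarith
    have h := (((hasDerivAt_id x).const_mul 2).const_add 1).rpow_const
      (p := -(d / 2 - 1)) (Or.inl hx'.ne')
    have h2 := h.const_mul (-(1 / (d - 2)))
    have : d - 2 ≠ 0 := by linarith
    refine h2.congr_deriv ?_
    simp only [id]
    rw [show -(d / 2 - 1) - 1 = -(d / 2) by ring]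
    field_simp
  have hpos : ∀ x ∈ Set.Ioi (0 : ℝ), 0 ≤ (1 + 2 * x) ^ (-(d / 2)) := by
    intro x hx
    have : (0 : ℝ) < x := hx
    positivity
  have hlim : Filter.Tendsto (fun t : ℝ => -(1 / (d - 2)) * (1 + 2 * t) ^ (-(d / 2 - 1)))
      Filter.atTop (nhds 0) := by
    have h1 : Filter.Tendsto (fun t : ℝ => 1 + 2 * t) Filter.atTop Filter.atTop :=
      Filter.tendsto_atTop_add_const_left _ _ (Filter.tendsto_id.const_mul_atTop two_pos)
    have h2 := ((tendsto_rpow_neg_atTop (y := d / 2 - 1) (by linarith)).comp h1).const_mul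
      (-(1 / (d - 2)))
    simpa using h2
  rw [← ofReal_integral_eq_lintegral_ofReal
    (integrableOn_Ioi_deriv_of_nonneg' hderiv hpos hlim)
    ((ae_restrict_iff' measurableSet_Ioi).2 (Filter.Eventually.of_forall hpos)),
    integral_Ioi_of_hasDerivAt_of_nonneg' hderiv hpos hlim]
  simp

/-- `𝔼 (1 / χ²_d) = 1 / (d - 2)` for `d > 2`, obtained by integrating the Laplace transform
`𝔼 exp (-t χ²_d) = (1 + 2 t) ^ (-d / 2)` over `t > 0`. -/
theorem lintegral_inv_sum_sq_gaussianPi {κ : Type*} [Fintype κ] (hκ : 2 < Fintype.card κ) :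
    ∫⁻ x, (ENNReal.ofReal (∑ a, x a ^ 2))⁻¹ ∂(gaussianPi κ)
      = ENNReal.ofReal (1 / ((Fintype.card κ : ℝ) - 2)) := by
  have h1 : ∀ x : κ → ℝ, (ENNReal.ofReal (∑ a, x a ^ 2))⁻¹
      = ∫⁻ t in Set.Ioi (0 : ℝ), ENNReal.ofReal (Real.exp (-t * ∑ a, x a ^ 2)) := fun x =>
    (lintegral_Ioi_exp_neg_mul (by positivity)).symm
  simp_rw [h1]
  rw [lintegral_lintegral_swap (Measurable.aemeasurable (by fun_prop)),
    ← lintegral_Ioi_one_add_two_mul_rpow (by exact_mod_cast hκ)]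
  refine setLIntegral_congr_fun measurableSet_Ioi fun t ht => ?_
  exact lintegral_exp_neg_mul_sum_sq_gaussianPi (le_of_lt ht)

/-! ### Distance to a subspace -/

/-- Rational coefficients suffice for the distance to a span; as an infimum over a countable set it is
then measurable in the spanning vectors. -/
theorem infDist_span_range_eq_iInf {E ι : Type*} [Fintype ι] [NormedAddCommGroup E]
    [NormedSpace ℝ E] (g : ι → E) (v : E) :
    Metric.infDist v (Submodule.span ℝ (Set.range g))
      = ⨅ q : ι → ℚ, dist v (∑ i, (q i : ℝ) • g i) := by
  have hcl : closure (Set.range fun q : ι → ℚ => ∑ i, (q i : ℝ) • g i)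
      = closure (Submodule.span ℝ (Set.range g) : Set E) := by
    have hc : Continuous fun c : ι → ℝ => ∑ i, c i • g i := by fun_prop
    have hd : DenseRange (Pi.map fun (_ : ι) (q : ℚ) => (q : ℝ)) :=
      DenseRange.piMap fun _ => Rat.denseRange_cast
    have hspan : (Submodule.span ℝ (Set.range g) : Set E)
        = Set.range fun c : ι → ℝ => ∑ i, c i • g i := by
      ext x
      simp [Submodule.mem_span_range_iff_exists_fun]
    refine subset_antisymm (closure_mono ?_) (closure_minimal ?_ isClosed_closure)
    · rw [hspan]
      rintro _ ⟨q, rfl⟩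
      exact ⟨fun i => q i, rfl⟩
    · rw [hspan]
      have := hc.range_subset_closure_image_dense hd
      rwa [← Set.range_comp] at this
  rw [← Metric.infDist_closure, ← hcl, Metric.infDist_closure, Metric.infDist_eq_iInf]
  exact Set.rangeFactorization_surjective.iInf_comp
    (g := fun y : Set.range fun q : ι → ℚ => ∑ i, (q i : ℝ) • g i => dist v (y : E)) |>.symm

theorem measurable_infDist_span {X E ι : Type*} [Fintype ι] [MeasurableSpace X]
    [NormedAddCommGroup E] [NormedSpace ℝ E] [MeasurableSpace E] [BorelSpace E]
    [SecondCountableTopology E] {g : ι → X → E} {v : X → E} (hg : ∀ i, Measurable (g i))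
    (hv : Measurable v) :
    Measurable fun x => Metric.infDist (v x) (Submodule.span ℝ (Set.range fun i => g i x)) := by
  simp_rw [infDist_span_range_eq_iInf]
  refine Measurable.iInf fun q => hv.dist (Finset.measurable_sum _ fun i _ => ?_)
  exact (hg i).const_smul _

theorem norm_sub_starProjection_eq_infDist {E : Type*} [NormedAddCommGroup E]
    [InnerProductSpace ℝ E] (W : Submodule ℝ E) [W.HasOrthogonalProjection] (v : E) :
    ‖v - W.starProjection v‖ = Metric.infDist v W := by
  rw [Submodule.starProjection_minimal, Metric.infDist_eq_iInf]
  simp_rw [dist_eq_norm]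
  rfl

/-- Bessel's inequality for an orthonormal family orthogonal to `W`. -/
theorem sum_sq_inner_le_infDist_sq {E κ : Type*} [NormedAddCommGroup E] [InnerProductSpace ℝ E]
    [Fintype κ] (W : Submodule ℝ E) [W.HasOrthogonalProjection] {e : κ → E}
    (he : Orthonormal ℝ e) (heW : ∀ a, e a ∈ Wᗮ) (v : E) :
    ∑ a, ⟪e a, v⟫ ^ 2 ≤ Metric.infDist v W ^ 2 := by
  rw [← norm_sub_starProjection_eq_infDist]
  have h := he.sum_inner_products_le (v - W.starProjection v) (s := Finset.univ)
  refine le_trans (le_of_eq (Finset.sum_congr rfl fun a _ => ?_)) h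
  rw [inner_sub_right, (Submodule.mem_orthogonal' W (e a)).1 (heW a) _
    (Submodule.starProjection_apply_mem W v), sub_zero, Real.norm_eq_abs, sq_abs]

/-- The `i`-th row of the matrix with entries `g`, as a vector of Euclidean space. -/
noncomputable abbrev rowVec {n l : ℕ} (g : Fin n × Fin l → ℝ) (i : Fin n) :
    EuclideanSpace ℝ (Fin l) :=
  WithLp.toLp 2 fun c => g (i, c)

theorem measurable_rowVec {n l : ℕ} (i : Fin n) :
    Measurable fun g : Fin n × Fin l → ℝ => rowVec g i := by
  unfold rowVec
  fun_prop

theorem gaussianPi_map_inner_rowVec {n l : ℕ} {κ : Type*} [Fintype κ] (i : Fin n)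
    {e : κ → EuclideanSpace ℝ (Fin l)} (he : Orthonormal ℝ e) :
    (gaussianPi (Fin n × Fin l)).map (fun g a => ⟪e a, rowVec g i⟫) = gaussianPi κ := by
  classical
  rw [← gaussianPi_map_of_orthonormal (fun (a : κ) (jc : Fin n × Fin l) =>
    if jc.1 = i then e a jc.2 else 0)]
  · congr 1
    funext g a
    simp [Fintype.sum_prod_type, PiLp.inner_apply, Finset.sum_ite_irrel, mul_comm]
  · intro a b
    have := orthonormal_iff_ite.1 he a b
    rw [← this]
    simp [Fintype.sum_prod_type, PiLp.inner_apply, Finset.sum_ite_irrel, mul_comm]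

/-- The squared distance of a Gaussian vector to a fixed subspace of codimension at least `d`
dominates a chi-squared variable with `d` degrees of freedom. -/
theorem lintegral_inv_infDist_sq_rowVec_le {n l d : ℕ} (i : Fin n)
    (W : Submodule ℝ (EuclideanSpace ℝ (Fin l))) (hd : 2 < d)
    (hW : Module.finrank ℝ W + d ≤ l) :
    ∫⁻ g, (ENNReal.ofReal (Metric.infDist (rowVec g i) W ^ 2))⁻¹ ∂(gaussianPi (Fin n × Fin l))
      ≤ ENNReal.ofReal (1 / ((d : ℝ) - 2)) := by
  have hfin : d ≤ Module.finrank ℝ Wᗮ := by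
    have h1 := Submodule.finrank_add_finrank_orthogonal W
    rw [finrank_euclideanSpace_fin] at h1
    omega
  let b := stdOrthonormalBasis ℝ Wᗮ
  let e : Fin d → EuclideanSpace ℝ (Fin l) := fun a => (b (Fin.castLE hfin a) : EuclideanSpace ℝ _)
  have he : Orthonormal ℝ e :=
    (b.orthonormal.comp_linearIsometry Wᗮ.subtypeₗᵢ).comp _ (Fin.castLE_injective hfin)
  have heW : ∀ a, e a ∈ Wᗮ := fun a => (b (Fin.castLE hfin a)).2
  calc ∫⁻ g, (ENNReal.ofReal (Metric.infDist (rowVec g i) W ^ 2))⁻¹ ∂(gaussianPi (Fin n × Fin l))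
      ≤ ∫⁻ g, (ENNReal.ofReal (∑ a, ⟪e a, rowVec g i⟫ ^ 2))⁻¹ ∂(gaussianPi (Fin n × Fin l)) :=
        lintegral_mono fun g => ENNReal.inv_le_inv.2
          (ENNReal.ofReal_le_ofReal (sum_sq_inner_le_infDist_sq W he heW _))
    _ = ∫⁻ x, (ENNReal.ofReal (∑ a, x a ^ 2))⁻¹ ∂(gaussianPi (Fin d)) := by
        rw [← gaussianPi_map_inner_rowVec i he, lintegral_map (by fun_prop)]
        refine measurable_pi_lambda _ fun a => ?_
        exact (measurable_rowVec i).const_inner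
    _ = ENNReal.ofReal (1 / ((d : ℝ) - 2)) := by
        rw [lintegral_inv_sum_sq_gaussianPi (by simpa using hd), Fintype.card_fin]

/-! ### The residual in an orthonormal basis -/

theorem frobNorm_sq_eq_sum_orthonormalBasis {m n : ℕ} (M : Matrix (Fin m) (Fin n) ℝ)
    (b : OrthonormalBasis (Fin n) ℝ (EuclideanSpace ℝ (Fin n))) :
    frobNorm M ^ 2 = ∑ i, ‖Matrix.toEuclideanLin M (b i)‖ ^ 2 := by
  rw [frobNorm, Real.sq_sqrt (by positivity)]
  simp_rw [EuclideanSpace.real_norm_sq_eq]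
  refine Eq.trans ?_ Finset.sum_comm
  refine Finset.sum_congr rfl fun r _ => ?_
  have h := b.sum_sq_inner_right (WithLp.toLp 2 (M r))
  rw [EuclideanSpace.real_norm_sq_eq] at h
  rw [← h]
  refine Finset.sum_congr rfl fun i _ => ?_
  simp [Matrix.toLpLin_apply, Matrix.mulVec, dotProduct, PiLp.inner_apply]

/-- The squared residual is the sum of the squared distances of the images of an orthonormal basis to
the range of `Y`. Any explicit vector of that range therefore gives an upper bound. -/
theorem frobNorm_sub_orthProj_mul_sq {m n l : ℕ} (A : Matrix (Fin m) (Fin n) ℝ)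
    (Y : Matrix (Fin m) (Fin l) ℝ) (b : OrthonormalBasis (Fin n) ℝ (EuclideanSpace ℝ (Fin n))) :
    frobNorm ((1 - orthProj Y) * A) ^ 2
      = ∑ i, Metric.infDist (Matrix.toEuclideanLin A (b i))
          (LinearMap.range (Matrix.toEuclideanLin Y)) ^ 2 := by
  rw [frobNorm_sq_eq_sum_orthonormalBasis _ b]
  refine Finset.sum_congr rfl fun i _ => ?_
  rw [← norm_sub_starProjection_eq_infDist]
  congr 2
  have h1 : Matrix.toEuclideanLin (orthProj Y)
      = ((LinearMap.range (Matrix.toEuclideanLin Y)).starProjection :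
        EuclideanSpace ℝ (Fin m) →ₗ[ℝ] EuclideanSpace ℝ (Fin m)) := by
    rw [orthProj, LinearEquiv.apply_symm_apply]
  have h2 : Matrix.toEuclideanLin ((1 - orthProj Y) * A) (b i)
      = Matrix.toEuclideanLin (1 - orthProj Y) (Matrix.toEuclideanLin A (b i)) := by
    simp [Matrix.toLpLin_apply, Matrix.mulVec_mulVec]
  rw [h2, map_sub, h1]
  simp [Matrix.toLpLin_apply]

theorem range_toEuclideanLin_eq_span {m l : ℕ} (Y : Matrix (Fin m) (Fin l) ℝ) :
    LinearMap.range (Matrix.toEuclideanLin Y)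
      = Submodule.span ℝ (Set.range fun c => WithLp.toLp 2 fun r => Y r c) := by
  ext x
  rw [Submodule.mem_span_range_iff_exists_fun, LinearMap.mem_range]
  have key : ∀ c : Fin l → ℝ, Matrix.toEuclideanLin Y (WithLp.toLp 2 c)
      = ∑ i, c i • (WithLp.toLp 2 fun r => Y r i : EuclideanSpace ℝ (Fin m)) := by
    intro c
    ext r
    simp [Matrix.toLpLin_apply, Matrix.mulVec, dotProduct, mul_comm]
  constructor
  · rintro ⟨y, rfl⟩
    exact ⟨y.ofLp, (key _).symm⟩
  · rintro ⟨c, rfl⟩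
    exact ⟨WithLp.toLp 2 c, key c⟩

theorem measurable_frobNorm_sub_orthProj_mul {X : Type*} [MeasurableSpace X] {m n l : ℕ}
    (A : Matrix (Fin m) (Fin n) ℝ) {Ω : X → Matrix (Fin n) (Fin l) ℝ}
    (hΩ : ∀ i j, Measurable fun x => Ω x i j) :
    Measurable fun x => frobNorm ((1 - orthProj (A * Ω x)) * A) := by
  have h : ∀ x, frobNorm ((1 - orthProj (A * Ω x)) * A)
      = √(∑ i, Metric.infDist (Matrix.toEuclideanLin A (EuclideanSpace.basisFun (Fin n) ℝ i))
          (LinearMap.range (Matrix.toEuclideanLin (A * Ω x))) ^ 2) := by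
    intro x
    rw [← frobNorm_sub_orthProj_mul_sq, Real.sqrt_sq]
    exact Real.sqrt_nonneg _
  simp_rw [h, range_toEuclideanLin_eq_span]
  refine Measurable.sqrt (Finset.measurable_sum _ fun i _ => Measurable.pow_const ?_ _)
  refine measurable_infDist_span (fun c => ?_) measurable_const
  simp only [Matrix.mul_apply]
  fun_prop

/-- The matrix `∑ i, b i ⊗ g i`, where `g i` is the `i`-th row of `g`: its `c`-th column is
`∑ i, g (i, c) • b i`, with coordinates `g (·, c)` in the orthonormal basis `b`. -/
noncomputable def rotatedMatrix {n l : ℕ}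
    (b : OrthonormalBasis (Fin n) ℝ (EuclideanSpace ℝ (Fin n))) (g : Fin n × Fin l → ℝ) :
    Matrix (Fin n) (Fin l) ℝ :=
  Matrix.of fun j c => ∑ i, b i j * g (i, c)

/-- Rotational invariance: `rotatedMatrix b` preserves the standard Gaussian law. -/
theorem gaussianPi_map_rotatedMatrix {n l : ℕ}
    (b : OrthonormalBasis (Fin n) ℝ (EuclideanSpace ℝ (Fin n))) :
    (gaussianPi (Fin n × Fin l)).map (fun g jc => rotatedMatrix b g jc.1 jc.2)
      = gaussianPi (Fin n × Fin l) := by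
  classical
  have h := gaussianPi_map_of_orthonormal (fun (jc ic : Fin n × Fin l) =>
    if ic.2 = jc.2 then b ic.1 jc.1 else 0) ?_
  · conv_rhs => rw [← h]
    congr 1
    funext g jc
    simp [rotatedMatrix, Fintype.sum_prod_type]
  · rintro ⟨j, c⟩ ⟨j', c'⟩
    have h2 := b.sum_inner_mul_inner (EuclideanSpace.single j' (1 : ℝ))
      (EuclideanSpace.single j (1 : ℝ))
    simp only [EuclideanSpace.inner_single_left, EuclideanSpace.inner_single_right, map_one,
      one_mul, conj_trivial, PiLp.single_apply] at h2
    simp only [Fintype.sum_prod_type, Prod.mk.injEq]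
    by_cases hc : c = c'
    · subst hc
      simp only [and_true]
      simpa [mul_comm] using h2
    · simp [hc, Ne.symm hc]

theorem toEuclideanLin_mul_rotatedMatrix {m n l : ℕ} (A : Matrix (Fin m) (Fin n) ℝ)
    (b : OrthonormalBasis (Fin n) ℝ (EuclideanSpace ℝ (Fin n))) (g : Fin n × Fin l → ℝ)
    (z : EuclideanSpace ℝ (Fin l)) :
    Matrix.toEuclideanLin (A * rotatedMatrix b g) z
      = ∑ i, ⟪rowVec g i, z⟫ • Matrix.toEuclideanLin A (b i) := by
  have h1 : Matrix.toEuclideanLin (A * rotatedMatrix b g) z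
      = Matrix.toEuclideanLin A (Matrix.toEuclideanLin (rotatedMatrix b g) z) := by
    simp [Matrix.toLpLin_apply, Matrix.mulVec_mulVec]
  have h2 : Matrix.toEuclideanLin (rotatedMatrix b g) z = ∑ i, ⟪rowVec g i, z⟫ • b i := by
    ext j
    simp only [Matrix.toLpLin_apply, Matrix.mulVec, dotProduct, rotatedMatrix, Matrix.of_apply,
      WithLp.ofLp_sum, Finset.sum_apply, WithLp.ofLp_smul, Pi.smul_apply, PiLp.inner_apply,
      RCLike.inner_apply, conj_trivial, smul_eq_mul]
    simp_rw [Finset.sum_mul]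
    rw [Finset.sum_comm]
    exact Finset.sum_congr rfl fun i _ => Finset.sum_congr rfl fun c _ => by ring
  rw [h1, h2, map_sum]
  simp_rw [map_smul]

/-- The vector `z = u / ‖u‖ ^ 2`, with `u` the component of `v` orthogonal to `W`. For `v` a row of a
matrix and `W` the span of its other rows this is a column of the pseudo-inverse. -/
theorem exists_dual_vector_of_infDist_ne_zero {E : Type*} [NormedAddCommGroup E]
    [InnerProductSpace ℝ E] (W : Submodule ℝ E) [W.HasOrthogonalProjection] {v : E} (hv : Metric.infDist v W ≠ 0) :
    ∃ z, (∀ w ∈ W, ⟪w, z⟫ = 0) ∧ ⟪v, z⟫ = 1 ∧ ‖z‖ ^ 2 = (Metric.infDist v W ^ 2)⁻¹ := by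
  rw [← norm_sub_starProjection_eq_infDist] at hv ⊢
  set u := v - W.starProjection v with hu
  have hperp : ∀ w ∈ W, ⟪w, u⟫ = 0 := fun w hw => by
    rw [real_inner_comm]
    exact W.starProjection_inner_eq_zero v w hw
  have hvu : ⟪v, u⟫ = ‖u‖ ^ 2 := by
    have : v = u + W.starProjection v := by simp [hu]
    rw [← real_inner_self_eq_norm_sq]
    nth_rewrite 1 [this]
    rw [inner_add_left, hperp _ (Submodule.starProjection_apply_mem W v), add_zero]
  refine ⟨(‖u‖ ^ 2)⁻¹ • u, fun w hw => ?_, ?_, ?_⟩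
  · rw [inner_smul_right, hperp w hw, mul_zero]
  · rw [inner_smul_right, hvu, inv_mul_cancel₀ (pow_ne_zero 2 hv)]
  · rw [norm_smul, mul_pow, norm_inv, norm_pow, norm_norm]
    field_simp

/-! ### Singular values -/

/-- There is an orthonormal basis of right singular vectors. -/
theorem exists_orthonormalBasis_norm_sq_eq_singularValue_sq {m n : ℕ}
    (A : Matrix (Fin m) (Fin n) ℝ) :
    ∃ b : OrthonormalBasis (Fin n) ℝ (EuclideanSpace ℝ (Fin n)),
      ∀ i : Fin n, ‖Matrix.toEuclideanLin A (b i)‖ ^ 2 = singularValue A (i + 1) ^ 2 := by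
  set T := Matrix.toEuclideanLin A with hT
  have hn : Module.finrank ℝ (EuclideanSpace ℝ (Fin n)) = n := finrank_euclideanSpace_fin
  refine ⟨T.isSymmetric_adjoint_comp_self.eigenvectorBasis hn, fun i => ?_⟩
  rw [singularValue, ← hT, Nat.add_sub_cancel, T.sq_singularValues_fin hn i,
    ← real_inner_self_eq_norm_sq, ← LinearMap.adjoint_inner_right, ← LinearMap.comp_apply,
    LinearMap.IsSymmetric.apply_eigenvectorBasis, RCLike.ofReal_real_eq_id, id, inner_smul_right,
    real_inner_self_eq_norm_sq, OrthonormalBasis.norm_eq_one]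
  simp

/-- The domain of `A` provides `n` singular values; those beyond `min m n` vanish because the rank is
at most `m`. -/
theorem sum_sq_singularValue_eq {m n : ℕ} (A : Matrix (Fin m) (Fin n) ℝ) {k : ℕ} :
    ∑ i : Fin n with k ≤ i.val, singularValue A (i + 1) ^ 2
      = ∑ j ∈ Finset.Ioc k (min m n), singularValue A j ^ 2 := by
  have hz : ∀ j, m ≤ j → (Matrix.toEuclideanLin A).singularValues j = 0 := by
    intro j hj
    rw [LinearMap.singularValues_eq_zero_iff_le_finrank_range]
    refine le_trans (Submodule.finrank_le _) ?_
    simpa using hj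
  have h1 : ∑ j ∈ Finset.Ioc k n, singularValue A j ^ 2
      = ∑ i : Fin n with k ≤ i.val, singularValue A (i + 1) ^ 2 := by
    symm
    refine Finset.sum_bij (fun (i : Fin n) _ => (i : ℕ) + 1) ?_ ?_ ?_ ?_
    · intro i hi
      have := i.2
      simp only [Finset.mem_filter, Finset.mem_univ, true_and] at hi
      simp only [Finset.mem_Ioc]
      omega
    · intro i _ j _ h
      exact Fin.ext (by simpa using h)
    · intro j hj
      simp only [Finset.mem_Ioc] at hj
      exact ⟨⟨j - 1, by omega⟩, by simp; omega, by simp; omega⟩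
    · intros; rfl
  rw [← h1]
  symm
  refine Finset.sum_subset (fun j hj => ?_) fun j hj hj' => ?_
  · simp only [Finset.mem_Ioc] at hj ⊢
    omega
  · simp only [Finset.mem_Ioc] at hj hj'
    rw [singularValue, hz _ (by omega)]
    simp

/-! ### Rows of a Gaussian matrix and their dual system -/

/-- The span of those among the first `k` rows of `g` whose index differs from `i`. -/
noncomputable def otherRowsSpan {n l : ℕ} (k : ℕ) (g : Fin n × Fin l → ℝ) (i : Fin n) :
    Submodule ℝ (EuclideanSpace ℝ (Fin l)) :=
  Submodule.span ℝ (Set.range fun j : {j : Fin n // j.val < k ∧ j ≠ i} => rowVec g j)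

theorem measurable_infDist_otherRowsSpan {n l : ℕ} (k : ℕ) (i : Fin n) :
    Measurable fun g : Fin n × Fin l → ℝ => Metric.infDist (rowVec g i) (otherRowsSpan k g i) :=
  measurable_infDist_span (fun j => measurable_rowVec j.1) (measurable_rowVec i)

theorem finrank_otherRowsSpan_lt {n l k : ℕ} (g : Fin n × Fin l → ℝ) {i : Fin n} (hi : i.val < k) :
    Module.finrank ℝ (otherRowsSpan k g i) < k := by
  refine lt_of_le_of_lt (finrank_range_le_card _) ?_
  rw [Fintype.card_subtype]
  calc (Finset.univ.filter fun j : Fin n => j.val < k ∧ j ≠ i).card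
      = ((Finset.univ.filter fun j : Fin n => j.val < k ∧ j ≠ i).map Fin.valEmbedding).card :=
        (Finset.card_map _).symm
    _ ≤ ((Finset.range k).erase i).card := by
        refine Finset.card_le_card fun j hj => ?_
        simp only [Finset.mem_map, Finset.mem_filter, Finset.mem_univ, true_and,
          Fin.valEmbedding_apply] at hj
        obtain ⟨j', ⟨h1, h2⟩, rfl⟩ := hj
        simp only [Finset.mem_erase, Finset.mem_range]
        exact ⟨fun h => h2 (Fin.ext h), h1⟩
    _ < k := by
        rw [Finset.card_erase_of_mem (by simpa using hi), Finset.card_range]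
        omega

/-- The `i`-th row is independent of the span of the other `k - 1` rows, a subspace of codimension at
least `p + 1`; hence the bound `1 / ((p + 1) - 2)`. -/
theorem lintegral_inv_infDist_sq_otherRowsSpan_le {n k p : ℕ} (hp : 2 ≤ p) {i : Fin n}
    (hi : i.val < k) :
    ∫⁻ g, (ENNReal.ofReal (Metric.infDist (rowVec g i) (otherRowsSpan k g i) ^ 2))⁻¹
        ∂(gaussianPi (Fin n × Fin (k + p)))
      ≤ ENNReal.ofReal (1 / ((p : ℝ) - 1)) := by
  classical
  have hmeas : Measurable fun g : Fin n × Fin (k + p) → ℝ =>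
      (ENNReal.ofReal (Metric.infDist (rowVec g i) (otherRowsSpan k g i) ^ 2))⁻¹ :=
    ((measurable_infDist_otherRowsSpan k i).pow_const 2).ennreal_ofReal.inv
  rw [lintegral_gaussianPi_eq_resample (fun jc : Fin n × Fin (k + p) => jc.1 ≠ i) hmeas]
  calc _ ≤ ∫⁻ _, ENNReal.ofReal (1 / ((p : ℝ) - 1)) ∂(gaussianPi (Fin n × Fin (k + p))) := by
        refine lintegral_mono fun g => ?_
        have hrank := finrank_otherRowsSpan_lt g hi
        refine le_trans (le_of_eq (lintegral_congr fun h => ?_))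
          ((lintegral_inv_infDist_sq_rowVec_le i (otherRowsSpan k g i) (d := p + 1) (by omega)
            (by omega)).trans (le_of_eq ?_))
        · have h1 : otherRowsSpan k (fun jc => if jc.1 ≠ i then g jc else h jc) i
              = otherRowsSpan k g i := by
            unfold otherRowsSpan
            congr 2
            funext j
            simp [rowVec, j.2.2]
          rw [h1]
          simp [rowVec]
        · congr 2
          push_cast
          ring
    _ = _ := by simp

/-! ### The expected squared residual -/

/-- Deterministic error bound. Let `Y = A * rotatedMatrix b g`. The vectors `z i` are dual to the first
`k` rows of `g`, so `Y (z i)` equals `A (b i)` up to a combination of the `A (b j)` with `k ≤ j`; it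
approximates `A (b i)` for `i < k`, and `0` approximates it for `k ≤ i`. -/
theorem frobNorm_sub_orthProj_mul_sq_le {m n l k : ℕ} (A : Matrix (Fin m) (Fin n) ℝ)
    (b : OrthonormalBasis (Fin n) ℝ (EuclideanSpace ℝ (Fin n))) (g : Fin n × Fin l → ℝ)
    (z : Fin n → EuclideanSpace ℝ (Fin l))
    (hz : ∀ i j : Fin n, i.val < k → j.val < k → ⟪rowVec g j, z i⟫ = if j = i then 1 else 0) :
    frobNorm ((1 - orthProj (A * rotatedMatrix b g)) * A) ^ 2
      ≤ ∑ i : Fin n with k ≤ i.val, ‖Matrix.toEuclideanLin A (b i)‖ ^ 2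
        + ∑ i : Fin n with i.val < k,
          ‖∑ j : Fin n with k ≤ j.val, ⟪rowVec g j, z i⟫ • Matrix.toEuclideanLin A (b j)‖ ^ 2 := by
  rw [frobNorm_sub_orthProj_mul_sq _ _ b, add_comm,
    ← Finset.sum_filter_add_sum_filter_not Finset.univ (fun i : Fin n => i.val < k)]
  simp_rw [not_lt]
  refine add_le_add (Finset.sum_le_sum fun i hi => ?_) (Finset.sum_le_sum fun i _ => ?_)
  · have hik : i.val < k := (Finset.mem_filter.1 hi).2
    refine pow_le_pow_left₀ Metric.infDist_nonneg ?_ 2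
    refine (Metric.infDist_le_dist_of_mem (LinearMap.mem_range_self _ (z i))).trans (le_of_eq ?_)
    rw [dist_comm, dist_eq_norm, toEuclideanLin_mul_rotatedMatrix,
      ← Finset.sum_filter_add_sum_filter_not Finset.univ (fun i : Fin n => i.val < k)]
    simp_rw [not_lt]
    have h1 : ∑ j : Fin n with j.val < k, ⟪rowVec g j, z i⟫ • Matrix.toEuclideanLin A (b j)
        = Matrix.toEuclideanLin A (b i) := by
      rw [Finset.sum_eq_single_of_mem i hi fun j hj hji => by
        rw [hz i j hik (Finset.mem_filter.1 hj).2, if_neg hji, zero_smul]]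
      rw [hz i i hik hik, if_pos rfl, one_smul]
    rw [h1, add_sub_cancel_left]
  · refine pow_le_pow_left₀ Metric.infDist_nonneg ?_ 2
    refine (Metric.infDist_le_dist_of_mem (zero_mem _)).trans (le_of_eq (dist_zero_right _))

/-- `𝔼 ‖B G z‖² = ‖B‖_F² ‖z‖²` for a Gaussian matrix `G` and the matrix `B` with columns `a j`. -/
theorem lintegral_norm_sq_sum_inner_rowVec_smul {m n l : ℕ} (s : Finset (Fin n))
    (a : Fin n → EuclideanSpace ℝ (Fin m)) (z : EuclideanSpace ℝ (Fin l)) :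
    ∫⁻ h, ENNReal.ofReal (‖∑ j ∈ s, ⟪rowVec h j, z⟫ • a j‖ ^ 2) ∂(gaussianPi (Fin n × Fin l))
      = ENNReal.ofReal (‖z‖ ^ 2 * ∑ j ∈ s, ‖a j‖ ^ 2) := by
  classical
  have h1 : ∀ h : Fin n × Fin l → ℝ, ENNReal.ofReal (‖∑ j ∈ s, ⟪rowVec h j, z⟫ • a j‖ ^ 2)
      = ∑ r, ENNReal.ofReal
        ((∑ jc : Fin n × Fin l, (if jc.1 ∈ s then a jc.1 r * z jc.2 else 0) * h jc) ^ 2) := by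
    intro h
    rw [EuclideanSpace.real_norm_sq_eq, ENNReal.ofReal_sum_of_nonneg fun _ _ => sq_nonneg _]
    refine Finset.sum_congr rfl fun r _ => ?_
    congr 2
    simp only [WithLp.ofLp_sum, Finset.sum_apply, WithLp.ofLp_smul, Pi.smul_apply,
      PiLp.inner_apply, RCLike.inner_apply, conj_trivial, smul_eq_mul, Fintype.sum_prod_type]
    rw [← Finset.sum_filter_add_sum_filter_not Finset.univ (· ∈ s)]
    rw [Finset.sum_eq_zero (s := Finset.univ.filter fun j => j ∉ s), add_zero]
    · simp only [Finset.filter_univ_mem]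
      refine Finset.sum_congr rfl fun j hj => ?_
      rw [Finset.sum_mul]
      refine Finset.sum_congr rfl fun c _ => ?_
      rw [if_pos hj]
      ring
    · intro j hj
      simp [(Finset.mem_filter.1 hj).2]
  simp_rw [h1]
  rw [lintegral_finsetSum _ fun r _ => by fun_prop]
  simp_rw [lintegral_gaussianPi_sq_linear]
  rw [← ENNReal.ofReal_sum_of_nonneg fun _ _ => by positivity]
  congr 1
  simp_rw [EuclideanSpace.real_norm_sq_eq, Fintype.sum_prod_type]
  rw [Finset.sum_comm, Finset.mul_sum, ← Finset.sum_filter_add_sum_filter_not Finset.univ (· ∈ s),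
    Finset.sum_eq_zero (s := Finset.univ.filter fun j => j ∉ s), add_zero]
  · simp only [Finset.filter_univ_mem]
    refine Finset.sum_congr rfl fun j hj => ?_
    simp_rw [if_pos hj, mul_pow, ← Finset.mul_sum, ← Finset.sum_mul]
    ring
  · intro j hj
    simp [(Finset.mem_filter.1 hj).2]

/-- The expected squared residual conditionally on the first `k` rows `g`. The sum on the right is the
squared Frobenius norm of the pseudo-inverse of these rows. -/
theorem lintegral_resample_frobNorm_sq_le {m n l k : ℕ} (A : Matrix (Fin m) (Fin n) ℝ)
    (b : OrthonormalBasis (Fin n) ℝ (EuclideanSpace ℝ (Fin n))) (g : Fin n × Fin l → ℝ)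
    (hg : ∀ i : Fin n, i.val < k → Metric.infDist (rowVec g i) (otherRowsSpan k g i) ≠ 0) :
    ∫⁻ h, ENNReal.ofReal (frobNorm ((1 - orthProj (A * rotatedMatrix b
        (fun jc => if jc.1.val < k then g jc else h jc))) * A) ^ 2) ∂(gaussianPi (Fin n × Fin l))
      ≤ ENNReal.ofReal (∑ i : Fin n with k ≤ i.val, ‖Matrix.toEuclideanLin A (b i)‖ ^ 2)
        * (1 + ∑ i : Fin n with i.val < k,
          (ENNReal.ofReal (Metric.infDist (rowVec g i) (otherRowsSpan k g i) ^ 2))⁻¹) := by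
  have hex : ∀ i : Fin n, ∃ z : EuclideanSpace ℝ (Fin l), i.val < k →
      (∀ w ∈ otherRowsSpan k g i, ⟪w, z⟫ = 0) ∧ ⟪rowVec g i, z⟫ = 1 ∧
        ‖z‖ ^ 2 = (Metric.infDist (rowVec g i) (otherRowsSpan k g i) ^ 2)⁻¹ := by
    intro i
    by_cases hi : i.val < k
    · obtain ⟨z, hz⟩ := exists_dual_vector_of_infDist_ne_zero (otherRowsSpan k g i) (hg i hi)
      exact ⟨z, fun _ => hz⟩
    · exact ⟨0, fun h => absurd h hi⟩
  choose z hz using hex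
  set τ := ∑ i : Fin n with k ≤ i.val, ‖Matrix.toEuclideanLin A (b i)‖ ^ 2 with hτ
  have hτ0 : 0 ≤ τ := by positivity
  have hbound : ∀ h : Fin n × Fin l → ℝ,
      ENNReal.ofReal (frobNorm ((1 - orthProj (A * rotatedMatrix b
        (fun jc => if jc.1.val < k then g jc else h jc))) * A) ^ 2)
      ≤ ENNReal.ofReal τ + ∑ i : Fin n with i.val < k, ENNReal.ofReal
        (‖∑ j : Fin n with k ≤ j.val, ⟪rowVec h j, z i⟫ • Matrix.toEuclideanLin A (b j)‖ ^ 2) := by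
    intro h
    rw [← ENNReal.ofReal_sum_of_nonneg fun _ _ => by positivity,
      ← ENNReal.ofReal_add hτ0 (by positivity)]
    refine ENNReal.ofReal_le_ofReal ?_
    refine (frobNorm_sub_orthProj_mul_sq_le (k := k) A b _ z ?_).trans (le_of_eq ?_)
    · intro i j hi hj
      have hrow : rowVec (fun jc => if jc.1.val < k then g jc else h jc) j = rowVec g j := by
        simp [rowVec, hj]
      rw [hrow]
      split_ifs with hji
      · rw [hji]
        exact (hz i hi).2.1
      · exact (hz i hi).1 _ (Submodule.subset_span ⟨⟨j, hj, hji⟩, rfl⟩)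
    · congr 1
      refine Finset.sum_congr rfl fun i _ => ?_
      congr 2
      refine Finset.sum_congr rfl fun j hj => ?_
      have hj' : ¬ j.val < k := not_lt.2 (Finset.mem_filter.1 hj).2
      simp [rowVec, hj']
  refine (lintegral_mono hbound).trans (le_of_eq ?_)
  rw [lintegral_add_left measurable_const, lintegral_finsetSum _ fun i _ => by fun_prop]
  simp_rw [lintegral_norm_sq_sum_inner_rowVec_smul]
  rw [lintegral_const, measure_univ, mul_one, mul_add, mul_one, Finset.mul_sum]
  congr 1
  refine Finset.sum_congr rfl fun i hi => ?_
  have hik : i.val < k := (Finset.mem_filter.1 hi).2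
  have hne := hg i hik
  rw [(hz i hik).2.2, ← hτ, mul_comm, ENNReal.ofReal_mul hτ0,
    ENNReal.ofReal_inv_of_pos (by positivity)]

theorem lintegral_frobNorm_sq_rotatedMatrix_le {m n k p : ℕ} (hp : 2 ≤ p) (hkn : k ≤ n)
    (A : Matrix (Fin m) (Fin n) ℝ)
    (b : OrthonormalBasis (Fin n) ℝ (EuclideanSpace ℝ (Fin n))) :
    ∫⁻ g, ENNReal.ofReal (frobNorm ((1 - orthProj (A * rotatedMatrix b g)) * A) ^ 2)
        ∂(gaussianPi (Fin n × Fin (k + p)))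
      ≤ ENNReal.ofReal ((1 + (k : ℝ) / ((p : ℝ) - 1)) *
        ∑ i : Fin n with k ≤ i.val, ‖Matrix.toEuclideanLin A (b i)‖ ^ 2) := by
  have hp1 : (0 : ℝ) < (p : ℝ) - 1 := by
    have : (2 : ℝ) ≤ p := by exact_mod_cast hp
    linarith
  have hmeas : ∀ i : Fin n, Measurable fun g : Fin n × Fin (k + p) → ℝ =>
      (ENNReal.ofReal (Metric.infDist (rowVec g i) (otherRowsSpan k g i) ^ 2))⁻¹ := fun i =>
    ((measurable_infDist_otherRowsSpan k i).pow_const 2).ennreal_ofReal.inv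
  have hae : ∀ᵐ g ∂(gaussianPi (Fin n × Fin (k + p))), ∀ i : Fin n, i.val < k →
      Metric.infDist (rowVec g i) (otherRowsSpan k g i) ≠ 0 := by
    rw [ae_all_iff]
    intro i
    by_cases hi : i.val < k
    -- The inverse squared distance has finite expectation, hence is almost surely not `1 / 0 = ∞`.
    · filter_upwards [ae_lt_top (hmeas i) (ne_top_of_le_ne_top ENNReal.ofReal_ne_top
        (lintegral_inv_infDist_sq_otherRowsSpan_le hp hi))] with g hg _ h0
      simp [h0] at hg
    · exact Filter.Eventually.of_forall fun _ h => absurd h hi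
  have hF : Measurable fun g : Fin n × Fin (k + p) → ℝ =>
      ENNReal.ofReal (frobNorm ((1 - orthProj (A * rotatedMatrix b g)) * A) ^ 2) := by
    refine ((measurable_frobNorm_sub_orthProj_mul A fun i j => ?_).pow_const 2).ennreal_ofReal
    simp only [rotatedMatrix, Matrix.of_apply]
    fun_prop
  rw [lintegral_gaussianPi_eq_resample (fun jc : Fin n × Fin (k + p) => jc.1.val < k) hF]
  refine (lintegral_mono_ae (hae.mono fun g hg =>
    lintegral_resample_frobNorm_sq_le A b g hg)).trans ?_
  rw [lintegral_const_mul _ (by fun_prop), lintegral_add_left measurable_const, lintegral_const,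
    measure_univ, mul_one, lintegral_finsetSum _ fun i _ => hmeas i, mul_comm,
    ENNReal.ofReal_mul (by positivity), ENNReal.ofReal_add (by positivity) (by positivity),
    ENNReal.ofReal_one]
  gcongr
  calc ∑ i : Fin n with i.val < k, _
      ≤ ∑ i : Fin n with i.val < k, ENNReal.ofReal (1 / ((p : ℝ) - 1)) :=
        Finset.sum_le_sum fun i hi =>
          lintegral_inv_infDist_sq_otherRowsSpan_le hp (Finset.mem_filter.1 hi).2
    _ = ENNReal.ofReal ((k : ℝ) / ((p : ℝ) - 1)) := by
        rw [Finset.sum_const, nsmul_eq_mul, Fin.card_filter_val_lt, min_eq_right hkn,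
          ← ENNReal.ofReal_natCast, ← ENNReal.ofReal_mul (by positivity)]
        congr 1
        ring

/-! ### From the random matrix to its law -/

theorem IsStdGaussianMatrix.map_eq_gaussianPi {S : Type*} [MeasurableSpace S] {μ : Measure S}
    [IsProbabilityMeasure μ] {n l : ℕ} {Ω : S → Matrix (Fin n) (Fin l) ℝ}
    (hΩ : IsStdGaussianMatrix Ω μ) :
    μ.map (fun s (jc : Fin n × Fin l) => Ω s jc.1 jc.2) = gaussianPi (Fin n × Fin l) := by
  refine ((iIndepFun_iff_map_fun_eq_pi_map fun jc : Fin n × Fin l =>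
    (hΩ.hasLaw jc.1 jc.2).aemeasurable).1 hΩ.indep).trans ?_
  congr 1
  funext jc
  exact (hΩ.hasLaw jc.1 jc.2).map_eq

theorem integrable_and_integral_le_sqrt_of_lintegral_sq_le {S : Type*} [MeasurableSpace S]
    {μ : Measure S} [IsProbabilityMeasure μ] {f : S → ℝ} (hf : AEStronglyMeasurable f μ) {c : ℝ}
    (hc : 0 ≤ c) (h : ∫⁻ s, ENNReal.ofReal (f s ^ 2) ∂μ ≤ ENNReal.ofReal c) :
    Integrable f μ ∧ ∫ s, f s ∂μ ≤ √c := by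
  have hsq : Integrable (fun s => f s ^ 2) μ := by
    refine ⟨hf.pow 2, ?_⟩
    rw [hasFiniteIntegral_iff_ofReal (Filter.Eventually.of_forall fun _ => sq_nonneg _)]
    exact h.trans_lt ENNReal.ofReal_lt_top
  have hL2 : MemLp f 2 μ := (memLp_two_iff_integrable_sq hf).2 hsq
  refine ⟨hL2.integrable (by norm_num), Real.le_sqrt_of_sq_le ?_⟩
  -- `(𝔼 f)² ≤ 𝔼 f²`, as the variance is nonnegative.
  have hvar := variance_nonneg f μ
  rw [variance_eq_sub hL2] at hvar
  have hle : ∫ s, f s ^ 2 ∂μ ≤ c := by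
    rwa [← ENNReal.ofReal_le_ofReal_iff hc, ofReal_integral_eq_lintegral_ofReal hsq
      (Filter.Eventually.of_forall fun _ => sq_nonneg _)]
  have : (μ[f ^ 2] : ℝ) = ∫ s, f s ^ 2 ∂μ := rfl
  linarith

theorem theorem10p1 {S : Type*} [MeasurableSpace S] (μ : Measure S) [IsProbabilityMeasure μ]
    {m n : ℕ} (A : Matrix (Fin m) (Fin n) ℝ) (k p : ℕ) (hk : 2 ≤ k) (hp : 2 ≤ p)
    (hkp : k + p ≤ min m n) (Ω : S → Matrix (Fin n) (Fin (k + p)) ℝ)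
    (hΩ : IsStdGaussianMatrix Ω μ) :
    Integrable (fun s => frobNorm ((1 - orthProj (A * Ω s)) * A)) μ ∧
    ∫ s, frobNorm ((1 - orthProj (A * Ω s)) * A) ∂μ
      ≤ √(1 + (k : ℝ) / ((p : ℝ) - 1)) *
        √(∑ j ∈ Finset.Ioc k (min m n), singularValue A j ^ 2) := by
  have hp1 : (0 : ℝ) < (p : ℝ) - 1 := by
    have : (2 : ℝ) ≤ p := by exact_mod_cast hp
    linarith
  obtain ⟨b, hb⟩ := exists_orthonormalBasis_norm_sq_eq_singularValue_sq A
  let F : (Fin n × Fin (k + p) → ℝ) → ℝ := fun g =>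
    frobNorm ((1 - orthProj (A * Matrix.of fun j c => g (j, c))) * A)
  have hF : Measurable F := measurable_frobNorm_sub_orthProj_mul A fun i j => by
    simp only [Matrix.of_apply]
    fun_prop
  have hΩm : AEMeasurable (fun s (jc : Fin n × Fin (k + p)) => Ω s jc.1 jc.2) μ :=
    aemeasurable_pi_lambda _ fun jc => (hΩ.hasLaw jc.1 jc.2).aemeasurable
  rw [← Real.sqrt_mul (by positivity)]
  refine integrable_and_integral_le_sqrt_of_lintegral_sq_le
    (hF.comp_aemeasurable hΩm).aestronglyMeasurable (by positivity) ?_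
  calc ∫⁻ s, ENNReal.ofReal (F (fun jc => Ω s jc.1 jc.2) ^ 2) ∂μ
      = ∫⁻ g, ENNReal.ofReal (F g ^ 2) ∂(gaussianPi (Fin n × Fin (k + p))) := by
        rw [← hΩ.map_eq_gaussianPi, lintegral_map' (by fun_prop) hΩm]
    _ = ∫⁻ g, ENNReal.ofReal (F (fun jc => rotatedMatrix b g jc.1 jc.2) ^ 2)
          ∂(gaussianPi (Fin n × Fin (k + p))) := by
        conv_lhs => rw [← gaussianPi_map_rotatedMatrix b]
        refine lintegral_map (by fun_prop) ?_
        simp only [rotatedMatrix, Matrix.of_apply]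
        fun_prop
    _ ≤ _ := lintegral_frobNorm_sq_rotatedMatrix_le hp (by omega) A b
    _ = _ := by
        simp_rw [hb]
        rw [sum_sq_singularValue_eq]
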